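/- All rings are commutative with identity and all modules are unitary. Let $R$ be a ring. An $R$-module is Gorenstein projective if it is isomorphic to the image of a differential of a doubly infinite exact sequence of projective $R$-modules that remains exact under $\mathrm{Hom}_R(-,Q)$ for every projective $R$-module $Q$. The Gorenstein projective dimension $\mathrm{Gpd}_R(M)$ of an $R$-module $M$ is the least integer $k\ge 0$ for which there is an exact sequence $0\to G_k\to\cdots\to G_0\to M\to 0$ with all $G_i$ Gorenstein projective ($\infty$ if there is no such $k$), and $\mathrm{Ggldim}(R)=\sup\{\mathrm{Gpd}_R(M) : M \text{ an } R\text{-module}\}$. For an integer $n\ge 0$, the ring $R$ is called $n$-strongly Gorenstein ($n$-SG) if every $R$-module $M$ is strongly $n$-Gorenstein projective, that is, there is a short exact sequence $0\to M\to P\to M\to 0$ of $R$-modules with $\mathrm{pd}_R(P)\le n$, and $\mathrm{Ext}_R^{n+1}(M,Q)=0$ for every projective $R$-module $Q$. **Proposition 2.1.** For every ring $R$ and every integer $n\ge 0$, the following statements are equivalent: 1. $R$ is an $n$-SG ring. 2. $\mathrm{Ggldim}(R)\le n$, and for every $R$-module $M$ there exists a short exact sequence $0\to M\to P\to M\to 0$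 with $\mathrm{pd}_R(P)<\infty$. 3. $\mathrm{Ggldim}(R)<\infty$, and for every $R$-module $M$ there exists a short exact sequence $0\to M\to P\to M\to 0$ with $\mathrm{pd}_R(P)\le n$. -/

import Mathlib

universe u

namespace GorensteinSG

open CategoryTheory

variable {R : Type u} [CommRing R]

/-- There is a short exact sequence `0 → A → B → C → 0` of `R`-modules. -/
def HasShortExact (A B C : ModuleCat.{u} R) : Prop :=
  ∃ (f : A →ₗ[R] B) (g : B →ₗ[R] C),
    Function.Injective f ∧ Function.Exact f g ∧ Function.Surjective g

/-- A complete projective resolution `⋯ → P (-1) → P 0 → P 1 → ⋯`: a doubly infinite exact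
sequence of projective `R`-modules that stays exact under `Hom_R(-, Q)` for every projective
module `Q` (`LinearMap.lcomp R Q f` is the map `φ ↦ φ ∘ f`). -/
structure IsCompleteProjectiveResolution (P : ℤ → ModuleCat.{u} R)
    (f : ∀ i : ℤ, P i →ₗ[R] P (i + 1)) : Prop where
  projective : ∀ i, Module.Projective R (P i)
  exact : ∀ i, Function.Exact (f i) (f (i + 1))
  hom_exact : ∀ (Q : ModuleCat.{u} R), Module.Projective R Q →
    ∀ i, Function.Exact (LinearMap.lcomp R Q (f (i + 1))) (LinearMap.lcomp R Q (f i))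

/-- Gorenstein projective modules: images of a differential in a complete projective
resolution. -/
def IsGorensteinProjective (M : ModuleCat.{u} R) : Prop :=
  ∃ (P : ℤ → ModuleCat.{u} R) (f : ∀ i : ℤ, P i →ₗ[R] P (i + 1)),
    IsCompleteProjectiveResolution P f ∧ Nonempty (M ≃ₗ[R] LinearMap.range (f 0))

/-- `M` has a resolution `0 → G_n → ⋯ → G_1 → G_0 → M → 0` by Gorenstein projective modules,
given as the short exact sequences `0 → K → G_0 → M → 0` it is spliced from. -/
def HasGorensteinProjectiveResolution : ℕ → ModuleCat.{u} R → Prop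
  | 0, M => IsGorensteinProjective M
  | n + 1, M => ∃ K G : ModuleCat.{u} R, HasShortExact K G M ∧ IsGorensteinProjective G ∧
      HasGorensteinProjectiveResolution n K

/-- The Gorenstein projective dimension: the least length of a resolution by Gorenstein
projective modules, and `⊤` if there is no finite one. -/
noncomputable def Gpd (M : ModuleCat.{u} R) : ℕ∞ :=
  ⨅ (n : ℕ) (_ : HasGorensteinProjectiveResolution n M), (n : ℕ∞)

/-- `M` is strongly `n`-Gorenstein projective: there is a short exact sequence
`0 → M → P → M → 0` with `pd P ≤ n`, and `Ext^{n+1}(M, Q) = 0` for every projective `Q`. -/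
def IsStronglyGorensteinProjective (n : ℕ) (M : ModuleCat.{u} R) : Prop :=
  (∃ P : ModuleCat.{u} R, HasShortExact M P M ∧ projectiveDimension P ≤ n) ∧
    ∀ Q : ModuleCat.{u} R, Module.Projective R Q → Subsingleton (Abelian.Ext M Q (n + 1))

variable (R)

/-- The Gorenstein global dimension: the supremum of the Gorenstein projective dimensions of
all `R`-modules. -/
noncomputable def Ggldim : ℕ∞ :=
  ⨆ M : ModuleCat.{u} R, Gpd M

/-- `R` is an `n`-strongly Gorenstein (`n`-SG) ring: every `R`-module is strongly
`n`-Gorenstein projective. -/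
def IsSG (n : ℕ) : Prop :=
  ∀ M : ModuleCat.{u} R, IsStronglyGorensteinProjective n M

end GorensteinSG

namespace GorensteinSG

open CategoryTheory Abelian

section

variable {R : Type u} [CommRing R]

/-! Everything is measured by the vanishing of `Ext^i(-, Q)` for projective `Q`. A Gorenstein
projective resolution of length `n` forces vanishing for `i > n`, by dimension shifting. 1 → 2:
taking syzygies of `0 → M → P → M → 0` `n` times gives `0 → K → F → K → 0` with `F` projective.
Copies of it splice into a complete resolution of `K`, so `Gpd M ≤ n`
(`HasShortExact.hasGorensteinProjectiveResolution`). 2 → 3: for a module of finite projective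
dimension, the top nonzero `Ext` is already detected on projectives, so `pd P ≤ n`
(`ExtProjectiveVanishesFrom.hasProjectiveDimensionLT`). 3 → 1: the long exact sequence of `0 → M → P
→ M → 0` embeds `Ext^i(M, Q)` in `Ext^{i+1}(M, Q)` for `i > n`, so vanishing descends from high
degrees to `n + 1`. -/

/-- `Ext^i(M, Q) = 0` for all `i ≥ k` and all projective `Q`. -/
def ExtProjectiveVanishesFrom (k : ℕ) (M : ModuleCat.{u} R) : Prop :=
  ∀ Q : ModuleCat.{u} R, Module.Projective R Q → ∀ i, k ≤ i → Subsingleton (Ext M Q i)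

theorem ExtProjectiveVanishesFrom.mono {k l : ℕ} {M : ModuleCat.{u} R}
    (h : ExtProjectiveVanishesFrom k M) (hkl : k ≤ l) : ExtProjectiveVanishesFrom l M :=
  fun Q hQ i hi => h Q hQ i (hkl.trans hi)

/-! ### Long exact `Ext` sequences -/

theorem HasShortExact.exists_shortExact {A B C : ModuleCat.{u} R} (h : HasShortExact A B C) :
    ∃ (f : A ⟶ B) (g : B ⟶ C) (w : f ≫ g = 0), (ShortComplex.mk f g w).ShortExact := by
  obtain ⟨f, g, hf, hfg, hg⟩ := h
  exact ⟨ModuleCat.ofHom f, ModuleCat.ofHom g, by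
    ext x
    exact hfg.apply_apply_eq_zero x, ModuleCat.shortComplex_shortExact _ hfg hf hg⟩

theorem HasShortExact.subsingleton_ext_left {A B C Q : ModuleCat.{u} R} {i : ℕ}
    (h : HasShortExact A B C) (hB : Subsingleton (Ext B Q i))
    (hC : Subsingleton (Ext C Q (i + 1))) : Subsingleton (Ext A Q i) := by
  obtain ⟨f, g, w, hS⟩ := h.exists_shortExact
  refine subsingleton_of_forall_eq 0 fun x => ?_
  obtain ⟨y, hy⟩ := Ext.contravariant_sequence_exact₁ hS Q x (add_comm 1 i)
    (Subsingleton.elim (α := Ext C Q (i + 1)) _ _)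
  rw [← hy, Subsingleton.elim (α := Ext B Q i) y 0, Ext.comp_zero]

theorem HasShortExact.subsingleton_ext_right {A B C Q : ModuleCat.{u} R} {i : ℕ}
    (h : HasShortExact A B C) (hA : Subsingleton (Ext A Q i))
    (hB : Subsingleton (Ext B Q (i + 1))) : Subsingleton (Ext C Q (i + 1)) := by
  obtain ⟨f, g, w, hS⟩ := h.exists_shortExact
  refine subsingleton_of_forall_eq 0 fun x => ?_
  obtain ⟨y, hy⟩ := Ext.contravariant_sequence_exact₃ hS Q x
    (Subsingleton.elim (α := Ext B Q (i + 1)) _ _) (add_comm 1 i)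
  rw [← hy, Subsingleton.elim (α := Ext A Q i) y 0, Ext.comp_zero]

/-- If `Ext^1(C, Q) = 0`, then every map `A → Q` extends along `A → B`. -/
theorem exists_extension_of_subsingleton_ext {A B C Q : ModuleCat.{u} R}
    {f : A →ₗ[R] B} {g : B →ₗ[R] C} (hf : Function.Injective f) (hfg : Function.Exact f g)
    (hg : Function.Surjective g) (hC : Subsingleton (Ext C Q 1)) (φ : A →ₗ[R] Q) :
    ∃ ψ : B →ₗ[R] Q, ψ ∘ₗ f = φ := by
  have w : ModuleCat.ofHom f ≫ ModuleCat.ofHom g = 0 := by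
    ext x
    exact hfg.apply_apply_eq_zero x
  have hS : (ShortComplex.mk (ModuleCat.ofHom f) (ModuleCat.ofHom g) w).ShortExact :=
    ModuleCat.shortComplex_shortExact _ hfg hf hg
  obtain ⟨y, hy⟩ := Ext.contravariant_sequence_exact₁ hS Q (Ext.mk₀ (ModuleCat.ofHom φ))
    (add_zero 1) (Subsingleton.elim (α := Ext C Q 1) _ _)
  obtain ⟨ψ, rfl⟩ := Ext.addEquiv₀.symm.surjective y
  refine ⟨ψ.hom, ?_⟩
  have h2 : ModuleCat.ofHom f ≫ ψ = ModuleCat.ofHom φ := by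
    apply Ext.addEquiv₀.symm.injective
    change Ext.mk₀ _ = Ext.mk₀ _
    rw [← hy]
    exact (Ext.mk₀_comp_mk₀ _ _).symm
  exact congrArg ModuleCat.Hom.hom h2

/-- If `B` is projective and every map `A → Q` extends along `A → B`, then `Ext^1(C, Q) = 0`. -/
theorem subsingleton_ext_one_of_extension {A B C Q : ModuleCat.{u} R}
    {f : A →ₗ[R] B} {g : B →ₗ[R] C} (hf : Function.Injective f) (hfg : Function.Exact f g)
    (hg : Function.Surjective g) (hB : Subsingleton (Ext B Q 1))
    (hext : ∀ φ : A →ₗ[R] Q, ∃ ψ : B →ₗ[R] Q, ψ ∘ₗ f = φ) : Subsingleton (Ext C Q 1) := by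
  have w : ModuleCat.ofHom f ≫ ModuleCat.ofHom g = 0 := by
    ext x
    exact hfg.apply_apply_eq_zero x
  have hS : (ShortComplex.mk (ModuleCat.ofHom f) (ModuleCat.ofHom g) w).ShortExact :=
    ModuleCat.shortComplex_shortExact _ hfg hf hg
  refine subsingleton_of_forall_eq 0 fun x => ?_
  obtain ⟨y, hy⟩ := Ext.contravariant_sequence_exact₃ hS Q x
    (Subsingleton.elim (α := Ext B Q 1) _ _) (add_zero 1)
  obtain ⟨φ, rfl⟩ := Ext.addEquiv₀.symm.surjective y
  obtain ⟨ψ, hψ⟩ := hext φ.hom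
  have h2 : Ext.addEquiv₀.symm φ = (Ext.mk₀ (ModuleCat.ofHom f)).comp
      (Ext.mk₀ (ModuleCat.ofHom ψ)) (zero_add 0) := by
    rw [Ext.mk₀_comp_mk₀]
    change Ext.mk₀ _ = _
    congr 1
    exact ModuleCat.hom_ext hψ.symm
  rw [← hy, h2]
  exact hS.extClass_comp_assoc _

theorem subsingleton_ext_of_projective {P : ModuleCat.{u} R} (hP : Module.Projective R P)
    (Q : ModuleCat.{u} R) {i : ℕ} (hi : 1 ≤ i) : Subsingleton (Ext P Q i) := by
  obtain ⟨j, rfl⟩ := Nat.exists_eq_add_of_le' hi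
  have : Projective P := P.projective_of_categoryTheory_projective
  exact Ext.subsingleton_of_projective P Q j

theorem extProjectiveVanishesFrom_of_projective {P : ModuleCat.{u} R}
    (hP : Module.Projective R P) : ExtProjectiveVanishesFrom 1 P :=
  fun Q _ _ hi => subsingleton_ext_of_projective hP Q hi

/-! ### `Ext` vanishing from Gorenstein projective resolutions -/

/-- Dimension shifting along `0 → im f_i → P_{i+1} → im f_{i+1} → 0`. Exactness under `Hom(-, Q)`
enters only for `Ext^1`, where it extends maps `im f_i → Q` to `P_{i+1}`. -/
theorem IsCompleteProjectiveResolution.subsingleton_ext_range {P : ℤ → ModuleCat.{u} R}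
    {f : ∀ i : ℤ, P i →ₗ[R] P (i + 1)} (h : IsCompleteProjectiveResolution P f)
    {Q : ModuleCat.{u} R} (hQ : Module.Projective R Q) (j : ℕ) (i : ℤ) :
    Subsingleton (Ext (ModuleCat.of R (LinearMap.range (f i))) Q (j + 1)) := by
  obtain ⟨i, rfl⟩ : ∃ k, i = k + 1 := ⟨i - 1, by ring⟩
  have hinj : Function.Injective (LinearMap.range (f i)).subtype := Subtype.val_injective
  have hex : Function.Exact (LinearMap.range (f i)).subtype (f (i + 1)).rangeRestrict := by
    intro x
    rw [Subtype.ext_iff]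
    simpa using h.exact i x
  have hsurj := (f (i + 1)).surjective_rangeRestrict
  have hB : ∀ j, Subsingleton (Ext (P (i + 1)) Q (j + 1)) := fun j =>
    subsingleton_ext_of_projective (h.projective _) Q (Nat.le_add_left 1 j)
  cases j with
  | zero =>
    refine subsingleton_ext_one_of_extension (A := ModuleCat.of R (LinearMap.range (f i)))
      (B := P (i + 1)) (C := ModuleCat.of R (LinearMap.range (f (i + 1)))) hinj hex hsurj
      (hB 0) fun φ => ?_
    -- A second shift exposes the preceding differential `f k`, which the pullback of `φ` to `P (k +
    -- 1)` must kill.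
    obtain ⟨k, rfl⟩ : ∃ k, i = k + 1 := ⟨i - 1, by ring⟩
    have h0 : LinearMap.lcomp R Q (f k) (φ ∘ₗ (f (k + 1)).rangeRestrict) = 0 := by
      ext x
      have h1 : (f (k + 1)).rangeRestrict (f k x) = 0 :=
        Subtype.ext ((h.exact k).apply_apply_eq_zero x)
      simp [h1]
    obtain ⟨ψ, hψ⟩ := (h.hom_exact Q hQ k _).1 h0
    refine ⟨ψ, ?_⟩
    ext ⟨_, x, rfl⟩
    exact LinearMap.congr_fun hψ x
  | succ j =>
    exact HasShortExact.subsingleton_ext_right (A := ModuleCat.of R (LinearMap.range (f i)))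
      (C := ModuleCat.of R (LinearMap.range (f (i + 1)))) ⟨_, _, hinj, hex, hsurj⟩
      (h.subsingleton_ext_range hQ j i) (hB _)

theorem subsingleton_ext_of_linearEquiv {M N Q : ModuleCat.{u} R} (e : M ≃ₗ[R] N) {i : ℕ}
    (h : Subsingleton (Ext N Q i)) : Subsingleton (Ext M Q i) := by
  refine subsingleton_of_forall_eq 0 fun x => ?_
  have h1 := Ext.mk₀_id_comp x
  rw [← e.toModuleIso.hom_inv_id, ← Ext.mk₀_comp_mk₀,
    Ext.comp_assoc _ _ _ (zero_add 0) (zero_add i) (by omega),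
    Subsingleton.elim (α := Ext N Q i) ((Ext.mk₀ _).comp x _) 0, Ext.comp_zero] at h1
  exact h1.symm

theorem IsGorensteinProjective.extProjectiveVanishesFrom {M : ModuleCat.{u} R}
    (h : IsGorensteinProjective M) : ExtProjectiveVanishesFrom 1 M := by
  obtain ⟨P, f, hP, ⟨e⟩⟩ := h
  intro Q hQ i hi
  obtain ⟨j, rfl⟩ := Nat.exists_eq_add_of_le' hi
  exact subsingleton_ext_of_linearEquiv (N := ModuleCat.of R (LinearMap.range (f 0))) e
    (hP.subsingleton_ext_range hQ j 0)

theorem HasGorensteinProjectiveResolution.extProjectiveVanishesFrom {n : ℕ} :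
    ∀ {M : ModuleCat.{u} R}, HasGorensteinProjectiveResolution n M →
      ExtProjectiveVanishesFrom (n + 1) M := by
  induction n with
  | zero => exact fun h => IsGorensteinProjective.extProjectiveVanishesFrom h
  | succ n ih =>
    rintro M ⟨K, G, hs, hG, hK⟩ Q hQ i hi
    obtain ⟨i, rfl⟩ := Nat.exists_eq_add_of_le' (Nat.le_of_add_left_le hi)
    exact hs.subsingleton_ext_right (ih hK Q hQ i (by omega))
      (hG.extProjectiveVanishesFrom Q hQ _ (by omega))

theorem exists_resolution_of_Gpd_le {n : ℕ} {M : ModuleCat.{u} R} (h : Gpd M ≤ n) :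
    ∃ m ≤ n, HasGorensteinProjectiveResolution m M := by
  have h1 : Gpd M < (n + 1 : ℕ) := lt_of_le_of_lt h (by exact_mod_cast n.lt_succ_self)
  simp only [Gpd, iInf_lt_iff] at h1
  obtain ⟨m, hm, hlt⟩ := h1
  exact ⟨m, Nat.lt_succ_iff.1 (by exact_mod_cast hlt), hm⟩

theorem extProjectiveVanishesFrom_of_Ggldim_le {n : ℕ} (h : Ggldim R ≤ n) (M : ModuleCat.{u} R) :
    ExtProjectiveVanishesFrom (n + 1) M := by
  obtain ⟨m, hm, hM⟩ := exists_resolution_of_Gpd_le ((le_iSup Gpd M).trans h)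
  exact hM.extProjectiveVanishesFrom.mono (by omega)

/-! ### Gorenstein projective resolutions from `0 → M → P → M → 0` -/

/-- A module `K` with `0 → K → P → K → 0` exact, `P` projective and `Ext^1(K, Q) = 0` for
projective `Q` is Gorenstein projective. -/
theorem HasShortExact.isGorensteinProjective {K P : ModuleCat.{u} R} (h : HasShortExact K P K)
    (hP : Module.Projective R P) (hK : ExtProjectiveVanishesFrom 1 K) :
    IsGorensteinProjective K := by
  obtain ⟨f, g, hf, hfg, hg⟩ := h
  -- The complete resolution is constant: `P` in every degree, with differential `P → K → P`.
  refine ⟨fun _ => P, fun _ => f ∘ₗ g, ⟨fun _ => hP, fun _ x => ?_, fun Q hQ _ φ => ?_⟩, ?_⟩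
  · change f (g x) = 0 ↔ _
    rw [map_eq_zero_iff f hf, hfg x]
    constructor
    · rintro ⟨y, rfl⟩
      obtain ⟨z, rfl⟩ := hg y
      exact ⟨z, rfl⟩
    · rintro ⟨z, rfl⟩
      exact ⟨g z, rfl⟩
  · constructor
    · intro h0
      have h1 : ∀ y, φ (f y) = 0 := fun y => by
        obtain ⟨z, rfl⟩ := hg y
        exact LinearMap.congr_fun h0 z
      have hker : LinearMap.ker g ≤ LinearMap.ker φ := by
        intro x hx
        obtain ⟨y, rfl⟩ := (hfg x).1 hx
        exact h1 y
      -- A cocycle `φ` kills `im f = ker g`, so it factors through `g`; extending the factor along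
      -- `f` exhibits `φ` as a coboundary.
      let ψ : K →ₗ[R] Q := (LinearMap.ker g).liftQ φ hker ∘ₗ
        (g.quotKerEquivOfSurjective hg).symm.toLinearMap
      have hψ : ∀ x, ψ (g x) = φ x := fun x => by
        have : (g.quotKerEquivOfSurjective hg).symm (g x) = Submodule.Quotient.mk x := by
          rw [LinearEquiv.symm_apply_eq]
          rfl
        simp [ψ, this]
      obtain ⟨θ, hθ⟩ := exists_extension_of_subsingleton_ext hf hfg hg (hK Q hQ 1 le_rfl) ψ
      refine ⟨θ, ?_⟩
      ext x
      exact (LinearMap.congr_fun hθ (g x)).trans (hψ x)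
    · rintro ⟨θ, rfl⟩
      ext x
      simp [hfg.apply_apply_eq_zero]
  · refine ⟨(LinearEquiv.ofInjective f hf).trans (LinearEquiv.ofEq _ _ ?_)⟩
    exact (LinearMap.range_comp_of_range_eq_top f (LinearMap.range_eq_top.2 hg)).symm

theorem isGorensteinProjective_of_projective {P : ModuleCat.{u} R}
    (hP : Module.Projective R P) : IsGorensteinProjective P := by
  have h : HasShortExact P (ModuleCat.of R (P × P)) P :=
    ⟨LinearMap.inl R P P, LinearMap.snd R P P, LinearMap.inl_injective, .inl_snd,
      LinearMap.snd_surjective⟩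
  exact h.isGorensteinProjective (inferInstanceAs (Module.Projective R (P × P)))
    (extProjectiveVanishesFrom_of_projective hP)

/-- The first syzygies of an exact sequence `0 → M → P → M → 0`. -/
theorem HasShortExact.exists_syzygy {M P : ModuleCat.{u} R} (h : HasShortExact M P M) :
    ∃ K K' F F' : ModuleCat.{u} R, Module.Projective R F ∧ Module.Projective R F' ∧
      HasShortExact K F M ∧ HasShortExact K' F' P ∧ HasShortExact K K' K := by
  obtain ⟨f, g, hf, hfg, hg⟩ := h
  obtain ⟨π, hπ⟩ : ∃ π : (M →₀ R) →ₗ[R] M, Function.Surjective π :=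
    ⟨Finsupp.linearCombination R id, Finsupp.linearCombination_id_surjective R M⟩
  obtain ⟨l, hl⟩ := Module.projective_lifting_property g π hg
  have hl' : ∀ b, g (l b) = π b := fun b => LinearMap.congr_fun hl b
  -- Horseshoe construction with the same cover `π` at both ends, so that both end syzygies are `ker
  -- π`.
  let p : (M →₀ R) × (M →₀ R) →ₗ[R] P := (f ∘ₗ π).coprod l
  have hp : ∀ a b, p (a, b) = f (π a) + l b := fun a b => by simp [p]
  have hgp : ∀ a b, g (p (a, b)) = π b := fun a b => by
    rw [hp, map_add, hfg.apply_apply_eq_zero, zero_add, hl']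
  have hpsurj : Function.Surjective p := by
    intro y
    obtain ⟨b, hb⟩ := hπ (g y)
    obtain ⟨m, hm⟩ := (hfg (y - l b)).1 (by rw [map_sub, hl', hb, sub_self])
    obtain ⟨a, rfl⟩ := hπ m
    exact ⟨(a, b), by rw [hp, hm, sub_add_cancel]⟩
  refine ⟨ModuleCat.of R (LinearMap.ker π), ModuleCat.of R (LinearMap.ker p),
    ModuleCat.of R (M →₀ R), ModuleCat.of R ((M →₀ R) × (M →₀ R)),
    inferInstanceAs (Module.Projective R (M →₀ R)),
    inferInstanceAs (Module.Projective R ((M →₀ R) × (M →₀ R))),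
    ⟨(LinearMap.ker π).subtype, π, Subtype.val_injective, π.exact_subtype_ker_map, hπ⟩,
    ⟨(LinearMap.ker p).subtype, p, Subtype.val_injective, p.exact_subtype_ker_map, hpsurj⟩,
    (LinearMap.inl R _ _ ∘ₗ (LinearMap.ker π).subtype).codRestrict _ fun a => ?_,
    (LinearMap.snd R _ _ ∘ₗ (LinearMap.ker p).subtype).codRestrict _ fun x => ?_, ?_, ?_, ?_⟩
  · change p (a.1, 0) = 0
    rw [hp, a.2, map_zero, map_zero, add_zero]
  · change π x.1.2 = 0
    rw [← hgp x.1.1, Prod.mk.eta, x.2, map_zero]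
  · intro a b hab
    exact Subtype.ext (congrArg (fun x => x.1.1) hab)
  · rintro ⟨⟨a, b⟩, hab⟩
    constructor
    · intro h0
      obtain rfl : b = 0 := congrArg Subtype.val h0
      have h1 : f (π a) = 0 := by
        have := LinearMap.mem_ker.1 hab
        rwa [hp, map_zero, add_zero] at this
      exact ⟨⟨a, (map_eq_zero_iff f hf).1 h1⟩, rfl⟩
    · rintro ⟨c, hc⟩
      exact Subtype.ext (congrArg (fun x => x.1.2) hc).symm
  · rintro ⟨b, hb⟩
    obtain ⟨m, hm⟩ := (hfg (l b)).1 ((hl' b).trans hb)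
    -- Since `l b = f m`, a first coordinate over `-m` puts `(a, b)` in `ker p`.
    obtain ⟨a, ha⟩ := hπ (-m)
    refine ⟨⟨(a, b), ?_⟩, rfl⟩
    rw [LinearMap.mem_ker, hp, ha, map_neg, hm, neg_add_cancel]

theorem HasShortExact.hasProjectiveDimensionLE_syzygy {K F M : ModuleCat.{u} R} {n : ℕ}
    (h : HasShortExact K F M) (hF : Module.Projective R F)
    (hM : HasProjectiveDimensionLE M (n + 1)) : HasProjectiveDimensionLE K n := by
  obtain ⟨f, g, w, hS⟩ := h.exists_shortExact
  exact (hS.hasProjectiveDimensionLT_X₃_iff n F.projective_of_categoryTheory_projective).1 hM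

theorem HasShortExact.extProjectiveVanishesFrom_syzygy {K F M : ModuleCat.{u} R} {n : ℕ}
    (h : HasShortExact K F M) (hF : Module.Projective R F)
    (hM : ExtProjectiveVanishesFrom (n + 2) M) : ExtProjectiveVanishesFrom (n + 1) K :=
  fun Q hQ i hi => h.subsingleton_ext_left (subsingleton_ext_of_projective hF Q (by omega))
    (hM Q hQ (i + 1) (by omega))

/-- Passing to syzygies lowers both bounds by one and keeps the shape of the sequence; at `n = 0`
the middle term is projective and the sequence splices with itself. -/
theorem HasShortExact.hasGorensteinProjectiveResolution {n : ℕ} :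
    ∀ {M P : ModuleCat.{u} R}, HasShortExact M P M → HasProjectiveDimensionLE P n →
      ExtProjectiveVanishesFrom (n + 1) M → HasGorensteinProjectiveResolution n M := by
  induction n with
  | zero =>
    intro M P h hP hM
    have : Projective P := (projective_iff_hasProjectiveDimensionLE_zero P).2 hP
    exact h.isGorensteinProjective inferInstance hM
  | succ n ih =>
    intro M P h hP hM
    obtain ⟨K, K', F, F', hF, hF', hKM, hKP, hK⟩ := h.exists_syzygy
    exact ⟨K, F, hKM, isGorensteinProjective_of_projective hF,
      ih hK (hKP.hasProjectiveDimensionLE_syzygy hF' hP)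
        (hKM.extProjectiveVanishesFrom_syzygy hF hM)⟩

theorem Gpd_le_of_resolution {n : ℕ} {M : ModuleCat.{u} R}
    (h : HasGorensteinProjectiveResolution n M) : Gpd M ≤ n :=
  iInf₂_le n h

theorem exists_projective_shortExact (M : ModuleCat.{u} R) :
    ∃ K F : ModuleCat.{u} R, Module.Projective R F ∧ HasShortExact K F M :=
  ⟨ModuleCat.of R (LinearMap.ker (Finsupp.linearCombination R (id : M → M))),
    ModuleCat.of R (M →₀ R), inferInstanceAs (Module.Projective R (M →₀ R)),
    Submodule.subtype _, Finsupp.linearCombination R id, Subtype.val_injective,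
    LinearMap.exact_subtype_ker_map _, Finsupp.linearCombination_id_surjective R M⟩

/-! ### Moving vanishing between degrees -/

/-- Over a ring where `Ext^{n+1}(-, Q)` vanishes for projective `Q`, so do all higher `Ext`. -/
theorem extProjectiveVanishesFrom_of_forall {n : ℕ}
    (h : ∀ M Q : ModuleCat.{u} R, Module.Projective R Q → Subsingleton (Ext M Q (n + 1)))
    (M : ModuleCat.{u} R) : ExtProjectiveVanishesFrom (n + 1) M := by
  intro Q hQ i hi
  induction i, hi using Nat.le_induction generalizing M with
  | base => exact h M Q hQ
  | succ i hi ih =>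
    obtain ⟨K, F, hF, hK⟩ := exists_projective_shortExact M
    exact hK.subsingleton_ext_right (ih K) (subsingleton_ext_of_projective hF Q (by omega))

/-- A module of finite projective dimension with `Ext^i(P, Q) = 0` for all `i > n` and all
projective `Q` has projective dimension at most `n`. -/
theorem ExtProjectiveVanishesFrom.hasProjectiveDimensionLT {k m : ℕ} {P : ModuleCat.{u} R}
    (h : ExtProjectiveVanishesFrom k P) (hP : HasProjectiveDimensionLT P (k + m)) :
    HasProjectiveDimensionLT P k := by
  induction m with
  | zero => exact hP
  | succ m ih =>
    refine ih ((hasProjectiveDimensionLT_iff _ _).2 fun i hi N e => ?_)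
    -- The obstruction to lifting `e` to `Ext^i(P, F)` lies in `Ext^{i+1}(P, K)`, which is beyond
    -- the known bound on `pd P`; and `Ext^i(P, F) = 0` because `F` is projective.
    obtain ⟨K, F, hF, hK⟩ := exists_projective_shortExact N
    obtain ⟨f, g, w, hS⟩ := hK.exists_shortExact
    obtain ⟨y, hy⟩ := Ext.covariant_sequence_exact₃ P hS e rfl
      (Ext.eq_zero_of_hasProjectiveDimensionLT _ (k + (m + 1)) (by omega))
    have := h F hF i (by omega)
    rw [← hy, Subsingleton.elim (α := Ext P F i) y 0, Ext.zero_comp]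

/-- If `0 → M → P → M → 0` is exact with `pd P ≤ n` and `Ext^i(M, Q)` vanishes for large `i`,
then it vanishes for `i > n`. -/
theorem HasShortExact.extProjectiveVanishesFrom {M P : ModuleCat.{u} R} {k m : ℕ}
    (h : HasShortExact M P M) (hP : HasProjectiveDimensionLT P k)
    (hM : ExtProjectiveVanishesFrom (k + m) M) : ExtProjectiveVanishesFrom k M := by
  induction m with
  | zero => exact hM
  | succ m ih =>
    exact ih fun Q hQ i hi => h.subsingleton_ext_left
      (HasProjectiveDimensionLT.subsingleton P k i (by omega) Q) (hM Q hQ _ (by omega))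

theorem IsSG.Ggldim_le {n : ℕ} (h : IsSG R n) : Ggldim R ≤ n := by
  refine iSup_le fun M => ?_
  obtain ⟨⟨P, hs, hP⟩, -⟩ := h M
  exact Gpd_le_of_resolution (hs.hasGorensteinProjectiveResolution
    ((projectiveDimension_le_iff P n).1 hP)
    (extProjectiveVanishesFrom_of_forall (fun M => (h M).2) M))

end

end GorensteinSG

theorem proposition2p1 (R : Type u) [CommRing R] (n : ℕ) :
    List.TFAE [
      GorensteinSG.IsSG R n,
      GorensteinSG.Ggldim R ≤ n ∧ ∀ M : ModuleCat.{u} R, ∃ P : ModuleCat.{u} R,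
        GorensteinSG.HasShortExact M P M ∧ CategoryTheory.projectiveDimension P < ⊤,
      GorensteinSG.Ggldim R < ⊤ ∧ ∀ M : ModuleCat.{u} R, ∃ P : ModuleCat.{u} R,
        GorensteinSG.HasShortExact M P M ∧ CategoryTheory.projectiveDimension P ≤ n] := by
  tfae_have 1 → 2 := by
    intro h
    refine ⟨h.Ggldim_le, fun M => ?_⟩
    obtain ⟨⟨P, hs, hP⟩, -⟩ := h M
    exact ⟨P, hs, lt_top_iff_ne_top.2 ((CategoryTheory.projectiveDimension_ne_top_iff P).2
      ⟨n, (CategoryTheory.projectiveDimension_le_iff P n).1 hP⟩)⟩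
  tfae_have 2 → 3 := by
    rintro ⟨hG, h⟩
    refine ⟨hG.trans_lt (ENat.natCast_lt_top n), fun M => ?_⟩
    obtain ⟨P, hs, hP⟩ := h M
    obtain ⟨m, hm⟩ := (CategoryTheory.projectiveDimension_ne_top_iff P).1 hP.ne
    -- The finite bound is weakened to the form `n + 1 + m`, from which the descent to `n + 1`
    -- starts.
    have hm' : CategoryTheory.HasProjectiveDimensionLT P (n + 1 + m) :=
      CategoryTheory.hasProjectiveDimensionLT_of_ge P (m + 1) _ (by omega)
    exact ⟨P, hs, (CategoryTheory.projectiveDimension_le_iff P n).2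
      ((GorensteinSG.extProjectiveVanishesFrom_of_Ggldim_le hG P).hasProjectiveDimensionLT hm')⟩
  tfae_have 3 → 1 := by
    rintro ⟨hG, h⟩ M
    obtain ⟨P, hs, hP⟩ := h M
    obtain ⟨m, hm⟩ := ENat.ne_top_iff_exists.1 hG.ne
    have hM := (GorensteinSG.extProjectiveVanishesFrom_of_Ggldim_le hm.ge M).mono
      (show m + 1 ≤ n + 1 + m by omega)
    exact ⟨⟨P, hs, hP⟩, fun Q hQ => hs.extProjectiveVanishesFrom
      ((CategoryTheory.projectiveDimension_le_iff P n).1 hP) hM Q hQ (n + 1) le_rfl⟩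
  tfae_finish
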